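/- A map $K:X\times X\to\mathbb{C}$ is called positive definite if $\sum_{i,j=1}^{n}K(x_i,x_j)\,\xi_i\,\overline{\xi_j}$ is real and $\geq 0$ for all finite families $x_1,\dots,x_n\in X$ and $\xi_1,\dots,\xi_n\in\mathbb{C}$. Let $BS(1,2)=\langle u,t\mid utu^{-1}=t^2\rangle$ be the Baumslag–Solitar group. A representation of $BS(1,2)$ on a complex Hilbert space $H$ is a homomorphism $\rho$ from $BS(1,2)$ to the unitary group of $H$; it is given by the unitary operators $U=\rho(u)$ and $T=\rho(t)$, which satisfy $UTU^{-1}=T^2$. Inner products are linear in the first variable. **Theorem.** Let $K:\mathbb{Z}^2\times\mathbb{Z}^2\to\mathbb{C}$ be positive definite, and assume that $$K((j,k),(j',k'))=K((j+1,k),(j'+1,k'))\qquad(j,j',k,k'\in\mathbb{Z})$$ and $$K((j,k),(j',k'))=K((j,2^{-j}+k),(j',2^{-j'}+k'))\qquad(j,j'\leq 0,\ k,k'\in\mathbb{Z}).$$ Then there exist a complex Hilbert space $H$, a representation $\rho$ of $BS(1,2)$ on $H$, with $U=\rho(u)$ and $T=\rho(t)$, and a vector $\psi\in H$ such that $$\langle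 U^jT^k\psi,\,U^{j'}T^{k'}\psi\rangle=K((j,k),(j',k'))\qquad(j,j',k,k'\in\mathbb{Z})$$ and $\overline{\operatorname{span}}\{U^jT^k\psi\mid j,k\in\mathbb{Z}\}=H$. In particular, when $(j,k)$ is identified with $u^jt^k$, the positive definite map $K$ extends from the subset $\{u^jt^k\mid j,k\in\mathbb{Z}\}$ to the whole group: the map $L(x,y)=\langle\rho(x)\psi,\rho(y)\psi\rangle$ on $BS(1,2)\times BS(1,2)$ is positive definite, satisfies $L(gx,gy)=L(x,y)$ for all $g,x,y\in BS(1,2)$, and $L(u^jt^k,u^{j'}t^{k'})=K((j,k),(j',k'))$ for all $j,j',k,k'\in\mathbb{Z}$. -/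

import Mathlib

open scoped ComplexOrder

/-- A kernel `K : X × X → ℂ` is positive definite if for every finite family of points `x i` and
scalars `ξ i`, the sum `∑ i, ∑ j, K (x i) (x j) * ξ i * conj (ξ j)` is real and nonnegative
(this is what `0 ≤` means for complex numbers). -/
def IsPositiveDefiniteKernel {X : Type*} (K : X → X → ℂ) : Prop :=
  ∀ (n : ℕ) (x : Fin n → X) (ξ : Fin n → ℂ),
    0 ≤ ∑ i, ∑ j, K (x i) (x j) * ξ i * star (ξ j)

/-- The two generators of the Baumslag-Solitar group. -/
inductive BSGen : Type
  | u : BSGen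
  | t : BSGen

/-- The Baumslag-Solitar group `BS(1,2) = ⟨u, t | u t u⁻¹ = t²⟩`. -/
abbrev BS12 : Type :=
  PresentedGroup
    ({FreeGroup.of BSGen.u * FreeGroup.of BSGen.t * (FreeGroup.of BSGen.u)⁻¹ *
      (FreeGroup.of BSGen.t ^ 2)⁻¹} : Set (FreeGroup BSGen))

/-- The generator `u` of `BS(1,2)`. -/
def BS12.u : BS12 := PresentedGroup.of BSGen.u

/-- The generator `t` of `BS(1,2)`. -/
def BS12.t : BS12 := PresentedGroup.of BSGen.t

/-- A unitary representation of `BS(1,2)` on `H`. It is determined by the unitary operators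
`U = ρ u` and `T = ρ t`, which satisfy `U T U⁻¹ = T²`. -/
abbrev BS12Representation (H : Type*) [NormedAddCommGroup H] [InnerProductSpace ℂ H]
    [CompleteSpace H] : Type _ :=
  BS12 →* unitary (H →L[ℂ] H)

/-- The unitary operator `U = ρ u`. -/
noncomputable def BS12Representation.U {H : Type*} [NormedAddCommGroup H] [InnerProductSpace ℂ H]
    [CompleteSpace H] (ρ : BS12Representation H) : unitary (H →L[ℂ] H) := ρ BS12.u

/-- The unitary operator `T = ρ t`. -/
noncomputable def BS12Representation.T {H : Type*} [NormedAddCommGroup H] [InnerProductSpace ℂ H]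
    [CompleteSpace H] (ρ : BS12Representation H) : unitary (H →L[ℂ] H) := ρ BS12.t

/-- The vector `U ^ j T ^ k ψ`, for `j k : ℤ`. -/
noncomputable def BS12Representation.waveletVec {H : Type*} [NormedAddCommGroup H] [InnerProductSpace ℂ H]
    [CompleteSpace H] (ρ : BS12Representation H) (ψ : H) (j k : ℤ) : H :=
  ((BS12Representation.U ρ ^ j * BS12Representation.T ρ ^ k : unitary (H →L[ℂ] H)) :
    H →L[ℂ] H) ψ

/-! Realise `K` as the Gram kernel of a total family `e (j, k)` in a Hilbert space. Invariance in
`j` makes `e (j, k) ↦ e (j + 1, k)` a unitary `U`. The second invariance gives a unitary `X : e (j,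
k) ↦ e (j, 2 ^ (-j) + k)` only on the closed span `M` of the vectors with `j ≤ 0`, extended by the
identity on `Mᗮ`. Here `U⁻¹ M ⊆ M`, the spaces `U ^ n M` have dense union, and `U X U⁻¹ = X²` on
`M`.

The difficulty is to extend `X` from `M` to a unitary `T` on `H` with `U T U⁻¹ = T²`. Such a `T`
makes `U⁻ⁿ T Uⁿ` a `2 ^ n`-th root of `T`, so compatible iterated square roots `Y n` of `X` are
needed, all reduced by `M`; then `T (Uⁿ x) = Uⁿ (Y n) x` for `x ∈ M`. `exists_unitary_sq_eq`
provides square roots, `exists_unitary_sq_eq_of_conj_mul` makes them compatible with `U` and `M`,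
and `exists_unitary_conj_eq_sq` glues them. -/

/-! ### Positive definite kernels and their Hilbert spaces. -/

theorem IsPositiveDefiniteKernel.star_apply {X : Type*} {K : X → X → ℂ}
    (hK : IsPositiveDefiniteKernel K) (a b : X) : star (K a b) = K b a := by
  have h1 := fun x => (Complex.nonneg_iff.1 (hK 1 ![x] ![1])).2
  have h2 := (Complex.nonneg_iff.1 (hK 2 ![a, b] ![1, 1])).2
  have h3 := (Complex.nonneg_iff.1 (hK 2 ![a, b] ![1, Complex.I])).2
  have ha := h1 a
  have hb := h1 b
  simp [Fin.sum_univ_two] at h2 h3 ha hb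
  apply Complex.ext
  · simp
    linarith
  · simp
    linarith

theorem IsPositiveDefiniteKernel.sum_nonneg {X : Type*} {K : X → X → ℂ}
    (hK : IsPositiveDefiniteKernel K) (s : Finset X) (ξ : X → ℂ) :
    0 ≤ ∑ x ∈ s, ∑ y ∈ s, K x y * ξ x * star (ξ y) := by
  have h := hK s.card (fun i => (s.equivFin.symm i : X)) (fun i => ξ (s.equivFin.symm i))
  have hsum : ∀ g : X → ℂ, ∑ i, g (s.equivFin.symm i : X) = ∑ x ∈ s, g x := fun g => by
    rw [← Finset.sum_coe_sort s g]
    exact s.equivFin.symm.sum_comp fun x => g x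
  rw [← hsum fun x => ∑ y ∈ s, K x y * ξ x * star (ξ y)]
  refine h.trans_eq (Finset.sum_congr rfl fun i _ => ?_)
  exact hsum fun y => K (s.equivFin.symm i) y * ξ (s.equivFin.symm i) * star (ξ y)

/-- The Kolmogorov decomposition of a positive definite kernel. -/
theorem IsPositiveDefiniteKernel.exists_kolmogorov {X : Type} {K : X → X → ℂ}
    (hK : IsPositiveDefiniteKernel K) :
    ∃ (H : Type) (_ : NormedAddCommGroup H) (_ : InnerProductSpace ℂ H) (_ : CompleteSpace H)
      (e : X → H), (∀ x y, inner ℂ (e y) (e x) = K x y) ∧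
        (Submodule.span ℂ (Set.range e)).topologicalClosure = ⊤ := by
  -- The transpose accounts for `inner ℂ` being conjugate-linear in its first slot.
  let M : Matrix X X (ℂ →L[ℂ] ℂ) := .of fun x y => K y x • 1
  have hherm : M.IsHermitian := by
    ext x y
    simp [M, ← hK.star_apply x y]
  have hM : M.PosSemidef := by
    have htfae := (RKHS.posSemidef_tfae (K := M)).out 0 2
    refine htfae.2 ⟨hherm, fun v => ?_⟩
    have h := (Complex.nonneg_iff.1 (hK.sum_nonneg v.support v)).1
    rw [Finset.sum_comm] at h
    refine h.trans_eq (congrArg Complex.re ?_)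
    simp only [Finsupp.sum]
    refine Finset.sum_congr rfl fun x _ => Finset.sum_congr rfl fun y _ => ?_
    simp only [M, Matrix.of_apply, ← hK.star_apply x y]
    simp
    ring
  have : Fact M.PosSemidef := ⟨hM⟩
  refine ⟨RKHS.OfKernel M, inferInstance, inferInstance, inferInstance,
    fun x => RKHS.kerFun (RKHS.OfKernel M) x 1, fun x y => ?_, ?_⟩
  · rw [← RKHS.kernel_inner, RKHS.OfKernel.kernel_ofKernel]
    simp [M, ← hK.star_apply x y]
  · refine top_unique ((RKHS.kerFun_dense (RKHS.OfKernel M)).symm.le.trans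
      (Submodule.topologicalClosure_mono (Submodule.span_le.2 ?_)))
    rintro _ ⟨x, v, rfl⟩
    rw [← mul_one v, ← smul_eq_mul, map_smul]
    exact Submodule.smul_mem _ _ (Submodule.subset_span ⟨x, rfl⟩)

/-! ### Unitaries from isometric data, and square roots of unitaries. -/

theorem ContinuousLinearMap.eq_of_mul_eq_mul_right {H : Type*} [NormedAddCommGroup H]
    [InnerProductSpace ℂ H] {A B C : H →L[ℂ] H} (hC : DenseRange C)
    (h : A * C = B * C) : A = B := by
  refine ContinuousLinearMap.coeFn_injective (hC.equalizer A.continuous B.continuous ?_)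
  funext x
  exact DFunLike.congr_fun h x

section UnitaryOperators

variable {H : Type*} [NormedAddCommGroup H] [InnerProductSpace ℂ H] [CompleteSpace H]

theorem exists_unitary_of_norm_eq {E : Type*} [AddCommGroup E] [Module ℂ E] (e f : E →ₗ[ℂ] H)
    (he : DenseRange e) (hf : DenseRange f) (hef : ∀ x, ‖f x‖ = ‖e x‖) :
    ∃ R : unitary (H →L[ℂ] H), ∀ x, (R : H →L[ℂ] H) (e x) = f x := by
  refine ⟨Unitary.linearIsometryEquiv.symm
    ((LinearEquiv.refl ℂ E).extendOfIsometry e f he hf hef), fun x => ?_⟩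
  rw [Unitary.coe_symm_linearIsometryEquiv_apply]
  exact LinearEquiv.extendOfIsometry_eq (LinearEquiv.refl ℂ E) e f he hf hef x

theorem exists_unitary_of_inner_eq {ι : Type*} (v w : ι → H)
    (hv : (Submodule.span ℂ (Set.range v)).topologicalClosure = ⊤)
    (hw : (Submodule.span ℂ (Set.range w)).topologicalClosure = ⊤)
    (h : ∀ i j, inner ℂ (w i) (w j) = inner ℂ (v i) (v j)) :
    ∃ R : unitary (H →L[ℂ] H), ∀ i, (R : H →L[ℂ] H) (v i) = w i := by
  have hdense : ∀ v : ι → H, (Submodule.span ℂ (Set.range v)).topologicalClosure = ⊤ →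
      DenseRange (Finsupp.linearCombination ℂ v) := fun v hv => by
    rw [← Finsupp.range_linearCombination, ← Submodule.dense_iff_topologicalClosure_eq_top] at hv
    rwa [DenseRange, ← LinearMap.coe_range]
  obtain ⟨R, hR⟩ := exists_unitary_of_norm_eq _ _ (hdense v hv) (hdense w hw) fun x => by
    have : inner ℂ (Finsupp.linearCombination ℂ w x) (Finsupp.linearCombination ℂ w x) =
        inner ℂ (Finsupp.linearCombination ℂ v x) (Finsupp.linearCombination ℂ v x) := by
      simp only [Finsupp.linearCombination_apply, Finsupp.sum_inner, Finsupp.inner_sum,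
        inner_smul_left, inner_smul_right, h]
    rw [inner_self_eq_norm_sq_to_K, inner_self_eq_norm_sq_to_K] at this
    exact (pow_left_inj₀ (norm_nonneg _) (norm_nonneg _) two_ne_zero).1 (by exact_mod_cast this)
  exact ⟨R, fun i => by simpa using hR (Finsupp.single i 1)⟩

theorem ContinuousLinearMap.denseRange_of_ker_adjoint_eq_bot (A : H →L[ℂ] H)
    (hA : ∀ x, star A x = 0 → x = 0) : DenseRange A := by
  have h : (A.range).topologicalClosure = ⊤ := by
    rw [Submodule.topologicalClosure_eq_top_iff, ContinuousLinearMap.orthogonal_range,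
      Submodule.eq_bot_iff]
    exact fun x hx => hA x hx
  rw [← Submodule.dense_iff_topologicalClosure_eq_top] at h
  exact h

/-- A unitary operator `V` has a unitary square root that commutes with all self-adjoint
operators commuting with `V`. -/
theorem exists_unitary_sq_eq (V : unitary (H →L[ℂ] H)) :
    ∃ R : unitary (H →L[ℂ] H), R * R = V ∧
      ∀ B : H →L[ℂ] H, IsSelfAdjoint B → Commute B V → Commute B R := by
  set v : H →L[ℂ] H := (V : H →L[ℂ] H) with hv
  have hvs : v * star v = 1 := Unitary.mul_star_self_of_mem V.2
  have hsv : star v * v = 1 := Unitary.star_mul_self_of_mem V.2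
  -- Since `v A* = A`, one has `A² = v |A|²`, so the polar part of `A = 1 + v` is a square root of
  -- `v` off `ker A`. On `ker A`, where `v = -1`, the root is multiplication by `i`.
  set A : H →L[ℂ] H := 1 + v with hA
  have hsA : star A = 1 + star v := by simp [hA]
  have hvsA : v * star A = A := by rw [hsA, mul_add, hvs, hA, mul_one, add_comm]
  have hAn : A * star A = star A * A := by
    rw [hsA, hA]; simp only [mul_add, add_mul, hvs, hsv, one_mul, mul_one]; abel
  set P : H →L[ℂ] H := CFC.abs A
  have hPP : P * P = star A * A := CFC.abs_mul_abs A
  have hPs : star P = P := (CFC.abs_nonneg A).isSelfAdjoint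
  have hker : ∀ x, A x = 0 ↔ P x = 0 := fun x => by
    have h1 : inner ℂ (A x) (A x) = inner ℂ (P x) (P x) := by
      rw [← ContinuousLinearMap.adjoint_inner_right, ← ContinuousLinearMap.adjoint_inner_right,
        ← ContinuousLinearMap.star_eq_adjoint, ← ContinuousLinearMap.star_eq_adjoint, hPs]
      exact congrArg _ (DFunLike.congr_fun hPP.symm x)
    rw [← inner_self_eq_zero (𝕜 := ℂ), h1, inner_self_eq_zero]
  have hkers : ∀ x, star A x = 0 → A x = 0 := fun x hx => by
    rw [← hvsA]
    simp [hx]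
  set Q : H →L[ℂ] H := A.ker.starProjection
  have hQs : star Q = Q := isSelfAdjoint_starProjection _
  have hQQ : Q * Q = Q := Submodule.isIdempotentElem_starProjection _
  have hQmem : ∀ x, A (Q x) = 0 := fun x => Submodule.starProjection_apply_mem A.ker x
  have hQid : ∀ x, A x = 0 → Q x = x := fun x hx =>
    Submodule.starProjection_eq_self_iff.2 hx
  have hAQ : A * Q = 0 := ContinuousLinearMap.ext hQmem
  have hPQ : P * Q = 0 := ContinuousLinearMap.ext fun x => (hker _).1 (hQmem x)
  have hQP : Q * P = 0 := by simpa [hPs, hQs] using congrArg star hPQ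
  have hsAQ : star A * Q = 0 := by
    have : star v * A = star A := by rw [hA, hsA, mul_add, hsv, mul_one, add_comm]
    rw [← this, mul_assoc, hAQ, mul_zero]
  have hQA : Q * A = 0 := by simpa [hQs] using congrArg star hsAQ
  have hQsA : Q * star A = 0 := by simpa [hQs] using congrArg star hAQ
  have hvQ : v * Q = -Q := by
    have : v = A - 1 := by simp [hA]
    rw [this, sub_mul, hAQ, one_mul, zero_sub]
  -- Adding the projection `Q` onto `ker A` makes both ranges dense; the root `R` is determined by
  -- `R e = f`.
  set e : H →L[ℂ] H := P + Q with he
  set f : H →L[ℂ] H := A + Complex.I • Q with hf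
  have hes : star e = e := by simp [he, hPs, hQs]
  have hfs : star f = star A - Complex.I • Q := by simp [hf, hQs, sub_eq_add_neg]
  have hee : e * e = star A * A + Q := by
    simp only [he, mul_add, add_mul, hPQ, hQP, hPP, hQQ, zero_add, add_zero]
  have hsff : star f * f = star A * A + Q := by
    rw [hfs, hf]
    simp only [mul_add, sub_mul, mul_smul_comm, smul_mul_assoc, hsAQ, hQA, smul_zero, hQQ]
    simp [smul_smul]
  have hnorm : ∀ x, ‖f x‖ = ‖e x‖ := fun x => by
    have h1 : inner ℂ (f x) (f x) = inner ℂ (e x) (e x) := by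
      rw [← ContinuousLinearMap.adjoint_inner_right, ← ContinuousLinearMap.adjoint_inner_right,
        ← ContinuousLinearMap.star_eq_adjoint, ← ContinuousLinearMap.star_eq_adjoint, hes]
      exact congrArg _ (DFunLike.congr_fun (hsff.trans hee.symm) x)
    rw [inner_self_eq_norm_sq_to_K, inner_self_eq_norm_sq_to_K] at h1
    exact (pow_left_inj₀ (norm_nonneg _) (norm_nonneg _) two_ne_zero).1 (by exact_mod_cast h1)
  have heinj : ∀ x, e x = 0 → x = 0 := fun x hx => by
    have h1 : Q x = 0 := by
      have : (Q * e) x = Q x := by rw [he, mul_add, hQP, hQQ, zero_add]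
      rw [← this]
      simp [hx]
    have h2 : P x = 0 := by simpa [he, h1] using hx
    rw [← hQid x ((hker x).2 h2), h1]
  have hfinj : ∀ x, star f x = 0 → x = 0 := fun x hx => by
    have h1 : Q x = 0 := by
      have : (Q * star f) x = -(Complex.I • Q x) := by
        rw [hfs, mul_sub, hQsA, mul_smul_comm, hQQ, zero_sub]
        rfl
      rw [← neg_eq_zero, ← smul_eq_zero_iff_right Complex.I_ne_zero, smul_neg, ← this]
      simp [hx]
    have h2 : star A x = 0 := by simpa [hfs, h1] using hx
    rw [← hQid x (hkers x h2), h1]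
  have hed : DenseRange e := e.denseRange_of_ker_adjoint_eq_bot (by rw [hes]; exact heinj)
  have hfd : DenseRange f := f.denseRange_of_ker_adjoint_eq_bot hfinj
  obtain ⟨R, hR⟩ := exists_unitary_of_norm_eq (e : H →ₗ[ℂ] H) (f : H →ₗ[ℂ] H) hed hfd hnorm
  have hRe : (R : H →L[ℂ] H) * e = f := ContinuousLinearMap.ext hR
  have hcomm : ∀ B : H →L[ℂ] H, IsSelfAdjoint B → Commute B V → Commute B e ∧ Commute B f := by
    intro B hB hBV
    have hBA : Commute B A := (Commute.one_right B).add_right hBV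
    -- Self-adjointness of `B` makes it commute with `A*` too, hence with `|A|`.
    have hBP : Commute B P := hBA.symm.cfcAbs_right (by rw [hB.star_eq]; exact hBA.symm)
    have h1 : Q * (B * Q) = B * Q := ContinuousLinearMap.ext fun x => hQid _ (by
      have h : (A * B) (Q x) = (B * A) (Q x) := by rw [hBA.eq]
      simpa [hQmem] using h)
    have h2 : Q * B * Q = Q * B := by
      simpa [hQs, hB.star_eq, mul_assoc] using congrArg star h1
    have hBQ : Commute B Q := by
      rw [Commute, SemiconjBy, ← h1, ← h2, mul_assoc]
    exact ⟨hBP.add_right hBQ, hBA.add_right (hBQ.smul_right _)⟩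
  have hcommR : ∀ B : H →L[ℂ] H, Commute B e → Commute B f → Commute B R := by
    intro B h1 h2
    refine ContinuousLinearMap.eq_of_mul_eq_mul_right hed ?_
    rw [mul_assoc, hRe, mul_assoc, h1.eq, ← mul_assoc, hRe, h2.eq]
  refine ⟨R, Subtype.ext ?_, fun B hB hBV => hcommR B (hcomm B hB hBV).1 (hcomm B hB hBV).2⟩
  have hAP : Commute A P := by
    have : IsStarNormal A := ⟨hAn.symm⟩
    exact (CFC.commute_abs_self A).symm
  have hfe : Commute f e := by
    refine Commute.add_right (Commute.add_left hAP ?_) (Commute.add_left ?_ ?_)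
    · exact Commute.smul_left (hQP.trans hPQ.symm) _
    · exact hAQ.trans hQA.symm
    · exact (Commute.refl Q).smul_left _
  -- On the dense range of `e²`, the claim becomes `f² = v e²`; both sides equal `A² - Q`.
  refine ContinuousLinearMap.eq_of_mul_eq_mul_right (hed.comp hed e.continuous) (C := e * e) ?_
  have : ((R * R : unitary (H →L[ℂ] H)) : H →L[ℂ] H) * (e * e) = f * f := by
    rw [Submonoid.coe_mul, mul_assoc, ← mul_assoc (R : H →L[ℂ] H) e e, hRe, hfe.eq, ← mul_assoc,
      hRe]
  rw [this, hee, ← hv, mul_add v, hvQ, ← mul_assoc, hvsA, hf]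
  simp only [mul_add, add_mul, mul_smul_comm, smul_mul_assoc, hAQ, hQA, smul_zero]
  rw [hQQ, zero_add, smul_smul, Complex.I_mul_I]
  simp

end UnitaryOperators

/-! ### Extending a solution of `U X U⁻¹ = X²` from a subspace. -/

section ConjEqSq

variable {H : Type*} [NormedAddCommGroup H] [InnerProductSpace ℂ H] [CompleteSpace H]

/-- An arbitrary root of `X` need not satisfy the last condition. Instead a root of `W = U X U⁻¹` is
built that equals `X` on the range of `P`, which is consistent because `W = X²` there, and is then
conjugated back by `U`. -/
theorem exists_unitary_sq_eq_of_conj_mul (U X : unitary (H →L[ℂ] H)) (P : H →L[ℂ] H)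
    (hP : IsStarProjection P) (hUP : (U : H →L[ℂ] H) * P * star (U : H →L[ℂ] H) * P = P)
    (hXP : Commute (X : H →L[ℂ] H) P)
    (hUX : (U * X * U⁻¹ : unitary (H →L[ℂ] H)) * P = (X * X : unitary (H →L[ℂ] H)) * P) :
    ∃ Y : unitary (H →L[ℂ] H), Y * Y = X ∧ Commute (Y : H →L[ℂ] H) P ∧
      (U * Y * U⁻¹ : unitary (H →L[ℂ] H)) * P = X * P := by
  obtain ⟨R, hRW, hR⟩ := exists_unitary_sq_eq (U * X * U⁻¹)
  have hRW' : (R : H →L[ℂ] H) * R = (U * X * U⁻¹ : unitary (H →L[ℂ] H)) :=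
    congrArg Subtype.val hRW
  set W : unitary (H →L[ℂ] H) := U * X * U⁻¹ with hW
  have hWc : (W : H →L[ℂ] H) = U * X * star (U : H →L[ℂ] H) := rfl
  set u : H →L[ℂ] H := (U : H →L[ℂ] H)
  set x : H →L[ℂ] H := (X : H →L[ℂ] H)
  set w : H →L[ℂ] H := (W : H →L[ℂ] H)
  set r : H →L[ℂ] H := (R : H →L[ℂ] H)
  have hPP : P * P = P := hP.isIdempotentElem
  have hPs : star P = P := hP.isSelfAdjoint
  have hsuu : star u * u = 1 := Unitary.star_mul_self_of_mem U.2
  have hxsx : x * star x = 1 := Unitary.mul_star_self_of_mem X.2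
  have hsxx : star x * x = 1 := Unitary.star_mul_self_of_mem X.2
  have hrsr : r * star r = 1 := Unitary.mul_star_self_of_mem R.2
  have hsrr : star r * r = 1 := Unitary.star_mul_self_of_mem R.2
  have hsww : star w * w = 1 := Unitary.star_mul_self_of_mem W.2
  have hUX' : w * P = x * x * P := hUX
  -- The projection onto `U M`, where `M` is the range of `P`; `hUP` says `Q P = P`, that is, `M ⊆ U
  -- M`.
  set Q : H →L[ℂ] H := u * P * star u with hQ
  have hQs : star Q = Q := by simp [hQ, hPs, mul_assoc]
  have hPQ : P * Q = P := by simpa [hQs, hPs] using congrArg star hUP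
  have hxxP : Commute (x * x) P := hXP.mul_left hXP
  have hWP : Commute P w := by
    have h1 : star w * P = P * (star x * star x) := by
      calc star w * P = star w * (P * (x * x)) * (star x * star x) := by
            rw [mul_assoc, mul_assoc P, mul_assoc x, ← mul_assoc x (star x), hxsx, one_mul, hxsx,
              mul_one]
        _ = P * (star x * star x) := by
            rw [← hxxP.eq, ← hUX', ← mul_assoc (star w), hsww, one_mul]
    have h2 := congrArg star h1
    simp only [star_mul, star_star, hPs] at h2
    rw [Commute, SemiconjBy, h2, hUX']
  have hWQ : Commute Q w := by
    rw [Commute, SemiconjBy, hQ, hWc]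
    calc u * P * star u * (u * x * star u) = u * P * (star u * u) * x * star u := by noncomm_ring
      _ = u * x * (star u * u) * P * star u := by
          rw [hsuu, mul_one, mul_one, mul_assoc u P, ← hXP.eq, ← mul_assoc]
      _ = u * x * star u * (u * P * star u) := by noncomm_ring
  have hRP : Commute P r := hR P hPs hWP
  have hRQ : Commute Q r := hR Q hQs hWQ
  set N : H →L[ℂ] H := 1 - P with hN
  have hPN : P * N = 0 := by rw [hN, mul_sub, mul_one, hPP, sub_self]
  have hNP : N * P = 0 := by rw [hN, sub_mul, one_mul, hPP, sub_self]
  have hNN : N * N = N := by rw [hN, mul_sub, mul_one, ← hN, hNP, sub_zero]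
  have hNs : star N = N := by simp [hN, hPs]
  have hRN : Commute N r := (Commute.one_left r).sub_left hRP
  have hsP : star (x * P + r * N) = star x * P + star r * N := by
    rw [hXP.eq, ← hRN.eq]
    simp [hPs, hNs]
  have hexp : ∀ a b : H →L[ℂ] H, (a * P + b * N) * (x * P + r * N) = a * x * P + b * r * N := by
    intro a b
    calc (a * P + b * N) * (x * P + r * N)
        = (a * P + b * N) * (P * x + N * r) := by rw [hXP.eq, hRN.eq]
      _ = a * (P * P) * x + a * (P * N) * r + b * (N * P) * x + b * (N * N) * r := by noncomm_ring
      _ = a * (P * x) + b * (N * r) := by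
          rw [hPP, hNN, hPN, hNP]; noncomm_ring
      _ = a * x * P + b * r * N := by rw [← hXP.eq, hRN.eq, mul_assoc, mul_assoc]
  have hPadd : P + N = 1 := by rw [hN]; abel
  have hTmem : x * P + r * N ∈ unitary (H →L[ℂ] H) := by
    refine Unitary.mem_iff.2 ⟨?_, ?_⟩
    · rw [hsP, hexp, hsxx, hsrr, one_mul, one_mul, hPadd]
    · rw [hsP, hXP.eq, ← hRN.eq]
      calc (P * x + N * r) * (star x * P + star r * N)
          = P * (x * star x) * P + N * (r * star r) * N
              + P * x * star r * N + N * r * star x * P := by noncomm_ring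
        _ = 1 := by
          have h1 : P * x * star r * N = 0 := by
            have : star r * N = N * star r := by simpa [hNs] using congrArg star hRN.eq
            rw [mul_assoc, this, ← hXP.eq, mul_assoc x, ← mul_assoc P, hPN, zero_mul, mul_zero]
          have h2 : N * r * star x * P = 0 := by
            have : star x * P = P * star x := by simpa [hPs] using (congrArg star hXP.eq).symm
            rw [mul_assoc, this, hRN.eq, mul_assoc r, ← mul_assoc N, hNP, zero_mul, mul_zero]
          rw [h1, h2, hxsx, hrsr, mul_one, mul_one, hPP, hNN, hPadd, add_zero, add_zero]
  -- This root of `W` is `X` on `M` and `R` on `Mᗮ`. It commutes with `Q`, which is why its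
  -- conjugate `U⁻¹ T U` commutes with `P`.
  let T : unitary (H →L[ℂ] H) := ⟨x * P + r * N, hTmem⟩
  have hTT : T * T = W := Subtype.ext (by
    change (x * P + r * N) * (x * P + r * N) = w
    rw [hexp, ← hUX', hRW', ← mul_add, hPadd, mul_one])
  have hTQ : Commute Q (x * P + r * N) := by
    have h1 : Commute Q (x * P) :=
      calc Q * (x * P) = Q * P * x := by rw [hXP.eq, mul_assoc Q]
        _ = x * P * Q := by rw [hUP, mul_assoc x, hPQ, hXP.eq]
    have h2 : Commute Q N := by
      rw [Commute, SemiconjBy, hN, mul_sub, sub_mul, hUP, hPQ, mul_one, one_mul]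
    exact h1.add_right (hRQ.mul_right h2)
  refine ⟨U⁻¹ * T * U, ?_, ?_, ?_⟩
  · calc U⁻¹ * T * U * (U⁻¹ * T * U) = U⁻¹ * (T * T) * U := by group
      _ = X := by rw [hTT, hW]; group
  · change star u * (x * P + r * N) * u * P = P * (star u * (x * P + r * N) * u)
    calc star u * (x * P + r * N) * u * P
        = star u * ((x * P + r * N) * (u * P * (star u * u))) := by
          rw [hsuu, mul_one]; noncomm_ring
      _ = star u * ((x * P + r * N) * Q) * u := by rw [hQ]; noncomm_ring
      _ = (star u * u) * P * (star u * (x * P + r * N) * u) := by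
          rw [← hTQ.eq, hQ]; noncomm_ring
      _ = _ := by rw [hsuu, one_mul]
  · have : U * (U⁻¹ * T * U) * U⁻¹ = T := by group
    rw [this]
    change (x * P + r * N) * P = x * P
    rw [add_mul, mul_assoc, mul_assoc, hPP, hNP, mul_zero, add_zero]

/-- The one-step root can be iterated: on the range of `P`, `U Y U⁻¹ = X = Y²`, so `Y` satisfies the
hypotheses imposed on `X`. -/
theorem exists_seq_unitary_sq_eq (U X : unitary (H →L[ℂ] H)) (P : H →L[ℂ] H)
    (hP : IsStarProjection P) (hUP : (U : H →L[ℂ] H) * P * star (U : H →L[ℂ] H) * P = P)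
    (hXP : Commute (X : H →L[ℂ] H) P)
    (hUX : (U * X * U⁻¹ : unitary (H →L[ℂ] H)) * P = (X * X : unitary (H →L[ℂ] H)) * P) :
    ∃ Y : ℕ → unitary (H →L[ℂ] H), Y 0 = X ∧ (∀ n, Y (n + 1) * Y (n + 1) = Y n) ∧
      (∀ n, Commute (Y n : H →L[ℂ] H) P) ∧
      ∀ n, (U * Y (n + 1) * U⁻¹ : unitary (H →L[ℂ] H)) * P = Y n * P := by
  let S := {X : unitary (H →L[ℂ] H) // Commute (X : H →L[ℂ] H) P ∧
    (U * X * U⁻¹ : unitary (H →L[ℂ] H)) * P = (X * X : unitary (H →L[ℂ] H)) * P}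
  have hstep : ∀ X : S, ∃ Y : S, Y.1 * Y.1 = X.1 ∧
      (U * Y.1 * U⁻¹ : unitary (H →L[ℂ] H)) * P = X.1 * P := fun X => by
    obtain ⟨Y, h1, h2, h3⟩ := exists_unitary_sq_eq_of_conj_mul U X.1 P hP hUP X.2.1 X.2.2
    exact ⟨⟨Y, h2, by rw [h3, h1]⟩, h1, h3⟩
  choose g hg using hstep
  let Y : ℕ → S := fun n => Nat.rec ⟨X, hXP, hUX⟩ (fun _ => g) n
  exact ⟨fun n => (Y n).1, rfl, fun n => (hg (Y n)).1, fun n => (Y n).2.1, fun n => (hg (Y n)).2⟩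

/-- If `X` is a unitary operator reduced by a closed subspace `M`, the unitary operator `U`
satisfies `U⁻¹ M ⊆ M`, and `U X U⁻¹ = X²` holds on `M`, then the restriction of `X` to `M`
extends to a unitary operator `T` with `U T U⁻¹ = T²`, provided that `⋃ n, U ^ n M` is dense. -/
theorem exists_unitary_conj_eq_sq (U X : unitary (H →L[ℂ] H)) (M : Submodule ℂ H)
    [M.HasOrthogonalProjection]
    (hUM : ∀ x ∈ M, ((U⁻¹ : unitary (H →L[ℂ] H)) : H →L[ℂ] H) x ∈ M)
    (hdense : (Submodule.span ℂ (Set.range fun p : ℕ × M =>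
      ((U ^ p.1 : unitary (H →L[ℂ] H)) : H →L[ℂ] H) p.2)).topologicalClosure = ⊤)
    (hXM : Commute (X : H →L[ℂ] H) M.starProjection)
    (hUX : ∀ x ∈ M, ((U * X * U⁻¹ : unitary (H →L[ℂ] H)) : H →L[ℂ] H) x =
      ((X * X : unitary (H →L[ℂ] H)) : H →L[ℂ] H) x) :
    ∃ T : unitary (H →L[ℂ] H), U * T * U⁻¹ = T * T ∧
      ∀ x ∈ M, (T : H →L[ℂ] H) x = (X : H →L[ℂ] H) x := by
  have hPmem : ∀ x, M.starProjection x ∈ M := M.starProjection_apply_mem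
  have hPid : ∀ x ∈ M, M.starProjection x = x := fun x hx =>
    Submodule.starProjection_eq_self_iff.2 hx
  obtain ⟨Y, hY0, hYY, hYP, hUY⟩ := exists_seq_unitary_sq_eq U X M.starProjection
    isStarProjection_starProjection
    (by
      have h : M.starProjection * star (U : H →L[ℂ] H) * M.starProjection =
          star (U : H →L[ℂ] H) * M.starProjection :=
        ContinuousLinearMap.ext fun x => hPid _ (hUM _ (hPmem x))
      rw [mul_assoc, mul_assoc, ← mul_assoc M.starProjection, h, ← mul_assoc,
        Unitary.mul_star_self_of_mem U.2, one_mul])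
    hXM (ContinuousLinearMap.ext fun x => hUX _ (hPmem x))
  have hmem : ∀ B : H →L[ℂ] H, Commute B M.starProjection → ∀ x ∈ M, B x ∈ M := by
    intro B hB x hx
    rw [← hPid x hx]
    have : B (M.starProjection x) = M.starProjection (B x) := DFunLike.congr_fun hB.eq x
    rw [this]
    exact hPmem _
  have hYM : ∀ n, ∀ x ∈ M, (Y n : H →L[ℂ] H) x ∈ M := fun n => hmem _ (hYP n)
  have hYM' : ∀ n, ∀ x ∈ M, star (Y n : H →L[ℂ] H) x ∈ M := fun n => hmem _ (by
    simpa [(isSelfAdjoint_starProjection M).star_eq] using (hYP n).star_star)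
  have hUY' : ∀ n, ∀ x ∈ M, ((U * Y (n + 1) * U⁻¹ : unitary (H →L[ℂ] H)) : H →L[ℂ] H) x =
      (Y n : H →L[ℂ] H) x := fun n x hx => by
    rw [← hPid x hx]
    exact DFunLike.congr_fun (hUY n) x
  -- `T` will send `v p` to `w p`. The Gram matrices agree because two indices can be lifted to a
  -- common level `n + m`, where `v` and `w` are both given by unitaries applied to vectors of `M`.
  let v : ℕ × M → H := fun p => ((U ^ p.1 : unitary (H →L[ℂ] H)) : H →L[ℂ] H) p.2
  let w : ℕ × M → H := fun p => ((U ^ p.1 * Y p.1 : unitary (H →L[ℂ] H)) : H →L[ℂ] H) p.2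
  have hshift : ∀ n (x : M), ∃ y : M, v (n, x) = v (n + 1, y) ∧ w (n, x) = w (n + 1, y) := by
    refine fun n x => ⟨⟨_, hUM x x.2⟩, ?_, ?_⟩
    · change _ = ((U ^ (n + 1) * U⁻¹ : unitary (H →L[ℂ] H)) : H →L[ℂ] H) x
      rw [pow_succ, mul_inv_cancel_right]
    · change (U ^ n : unitary (H →L[ℂ] H)).1 ((Y n : H →L[ℂ] H) x) =
        ((U ^ (n + 1) * Y (n + 1) * U⁻¹ : unitary (H →L[ℂ] H)) : H →L[ℂ] H) x
      rw [← hUY' n x x.2, pow_succ, mul_assoc (U ^ n * U), mul_assoc (U ^ n), ← mul_assoc U]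
      rfl
  have hlift : ∀ d n (x : M), ∃ y : M, v (n, x) = v (n + d, y) ∧ w (n, x) = w (n + d, y) := by
    intro d n x
    induction d with
    | zero => exact ⟨x, rfl, rfl⟩
    | succ d ih =>
      obtain ⟨y, h1, h2⟩ := ih
      obtain ⟨z, h3, h4⟩ := hshift (n + d) y
      exact ⟨z, h1.trans h3, h2.trans h4⟩
  have hinner : ∀ p q, inner ℂ (w p) (w q) = inner ℂ (v p) (v q) := by
    rintro ⟨n, x⟩ ⟨m, y⟩
    obtain ⟨x', h1, h2⟩ := hlift m n x
    obtain ⟨y', h3, h4⟩ := hlift n m y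
    rw [add_comm m n] at h3 h4
    rw [h1, h2, h3, h4]
    exact (Unitary.inner_map_map _ _ _).trans (Unitary.inner_map_map _ _ _).symm
  have hwdense : (Submodule.span ℂ (Set.range w)).topologicalClosure = ⊤ := by
    refine top_unique (hdense.symm.le.trans
      (Submodule.topologicalClosure_mono (Submodule.span_mono ?_)))
    rintro _ ⟨⟨n, x⟩, rfl⟩
    -- `Y n` maps `M` onto `M`, since its adjoint preserves `M` as well.
    refine ⟨(n, ⟨_, hYM' n x x.2⟩), ?_⟩
    change ((U ^ n * Y n * (Y n)⁻¹ : unitary (H →L[ℂ] H)) : H →L[ℂ] H) x = _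
    rw [mul_inv_cancel_right]
  obtain ⟨T, hT⟩ := exists_unitary_of_inner_eq v w hdense hwdense hinner
  have hTv : ∀ n, ∀ x ∈ M, ((T * U ^ n : unitary (H →L[ℂ] H)) : H →L[ℂ] H) x =
    ((U ^ n * Y n : unitary (H →L[ℂ] H)) : H →L[ℂ] H) x := fun n x hx => hT (n, ⟨x, hx⟩)
  refine ⟨T, Subtype.ext (ContinuousLinearMap.ext_on
    (Submodule.dense_iff_topologicalClosure_eq_top.2 hdense) ?_), fun x hx => ?_⟩
  · rintro _ ⟨⟨n, x⟩, rfl⟩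
    obtain ⟨y, hy, -⟩ := hshift n x
    change (U * T * U⁻¹ : unitary (H →L[ℂ] H)).1 (v (n, x)) =
      (T * T : unitary (H →L[ℂ] H)).1 (v (n, x))
    rw [hy]
    calc (U * T * U⁻¹ * U ^ (n + 1) : unitary (H →L[ℂ] H)).1 y
        = (U * (T * U ^ n) : unitary (H →L[ℂ] H)).1 y := by
          rw [pow_succ', ← mul_assoc, inv_mul_cancel_right, mul_assoc]
      _ = (U * (U ^ n * (Y (n + 1) * Y (n + 1))) : unitary (H →L[ℂ] H)).1 y := by
          rw [hYY]
          exact congrArg U.1 (hTv n y y.2)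
      _ = (U ^ (n + 1) * Y (n + 1) : unitary (H →L[ℂ] H)).1 ((Y (n + 1)).1 y.1) := by
          rw [pow_succ', mul_assoc, ← mul_assoc (U ^ n)]
          rfl
      _ = (T * (T * U ^ (n + 1)) : unitary (H →L[ℂ] H)).1 y := by
          rw [← hTv _ _ (hYM _ _ y.2)]
          exact congrArg T.1 (hTv (n + 1) y y.2).symm
  · simpa [hY0] using hTv 0 x hx

end ConjEqSq

/-! ### Operators on closed spans. -/

section ClosedSpan

variable {H : Type*} [NormedAddCommGroup H] [InnerProductSpace ℂ H]

theorem ContinuousLinearMap.map_mem_of_mem_closure_span {s : Set H} {M : Submodule ℂ H}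
    (hM : IsClosed (M : Set H)) (B : H →L[ℂ] H) (hB : ∀ x ∈ s, B x ∈ M) {x : H}
    (hx : x ∈ (Submodule.span ℂ s).topologicalClosure) : B x ∈ M :=
  (Submodule.topologicalClosure_minimal (t := M.comap (B : H →ₗ[ℂ] H)) _ (Submodule.span_le.2 hB)
    (hM.preimage B.continuous)) hx

theorem ContinuousLinearMap.eq_of_mem_closure_span {s : Set H} {A B : H →L[ℂ] H}
    (h : ∀ x ∈ s, A x = B x) {x : H}
    (hx : x ∈ (Submodule.span ℂ s).topologicalClosure) : A x = B x := by
  have := (A - B).map_mem_of_mem_closure_span (M := ⊥) (by simp)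
    (fun x hx => by simp [h x hx]) hx
  simpa [sub_eq_zero] using this

end ClosedSpan

/-! ### Unitaries implementing a reindexing of vectors. -/

section Reindex

variable {H : Type*} [NormedAddCommGroup H] [InnerProductSpace ℂ H] [CompleteSpace H]

theorem exists_unitary_apply_eq_comp {ι : Type*} (v : ι → H) (σ : ι → ι)
    (hσ : Function.Surjective σ)
    (hv : (Submodule.span ℂ (Set.range v)).topologicalClosure = ⊤)
    (h : ∀ i j, inner ℂ (v (σ i)) (v (σ j)) = inner ℂ (v i) (v j)) :
    ∃ R : unitary (H →L[ℂ] H), ∀ i, (R : H →L[ℂ] H) (v i) = v (σ i) :=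
  exists_unitary_of_inner_eq v (v ∘ σ) hv (by rwa [hσ.range_comp]) h

/-- A Gram-matrix-preserving surjective reindexing of a family of vectors is implemented by a
unitary operator that is reduced by the closed span of the family. -/
theorem exists_unitary_apply_eq_comp_of_closure_span {ι : Type*} (v : ι → H) (σ : ι → ι)
    (hσ : Function.Surjective σ)
    (h : ∀ i j, inner ℂ (v (σ i)) (v (σ j)) = inner ℂ (v i) (v j)) :
    ∃ R : unitary (H →L[ℂ] H), (∀ i, (R : H →L[ℂ] H) (v i) = v (σ i)) ∧
      Commute (R : H →L[ℂ] H)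
        (Submodule.span ℂ (Set.range v)).topologicalClosure.starProjection := by
  set M := (Submodule.span ℂ (Set.range v)).topologicalClosure with hM
  have hvM : ∀ i, v i ∈ M := fun i =>
    Submodule.le_topologicalClosure _ (Submodule.subset_span ⟨i, rfl⟩)
  -- Adjoining all of `Mᗮ`, fixed pointwise, makes the family total and forces `R` to be reduced by
  -- `M`.
  let v' : ι ⊕ Mᗮ → H := Sum.elim v Subtype.val
  obtain ⟨R, hR⟩ := exists_unitary_apply_eq_comp v' (Sum.map σ id)
    (hσ.sumMap Function.surjective_id)
    (by
      rw [Submodule.topologicalClosure_eq_top_iff, Submodule.eq_bot_iff]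
      intro x hx
      have h1 : Submodule.span ℂ (Set.range v) ≤ Submodule.span ℂ (Set.range v') :=
        Submodule.span_mono (by rintro _ ⟨i, rfl⟩; exact ⟨Sum.inl i, rfl⟩)
      have h2 : Mᗮ ≤ Submodule.span ℂ (Set.range v') := fun y hy =>
        Submodule.subset_span ⟨Sum.inr ⟨y, hy⟩, rfl⟩
      have h3 : x ∈ Mᗮ := by
        rw [hM, Submodule.orthogonal_closure]
        exact Submodule.orthogonal_le h1 hx
      exact inner_self_eq_zero.1 (Submodule.inner_right_of_mem_orthogonal (h2 h3) hx))
    (by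
      rintro (i | x) (j | y)
      · exact h i j
      · exact (Submodule.inner_right_of_mem_orthogonal (hvM _) y.2).trans
          (Submodule.inner_right_of_mem_orthogonal (hvM _) y.2).symm
      · exact (Submodule.inner_left_of_mem_orthogonal (hvM _) x.2).trans
          (Submodule.inner_left_of_mem_orthogonal (hvM _) x.2).symm
      · rfl)
  refine ⟨R, fun i => hR (Sum.inl i), ContinuousLinearMap.ext fun x => ?_⟩
  have hRM : ∀ x ∈ M, (R : H →L[ℂ] H) x ∈ M := fun x hx =>
    R.1.map_mem_of_mem_closure_span (Submodule.isClosed_topologicalClosure _)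
      (by rintro _ ⟨i, rfl⟩; exact (hR (Sum.inl i)).symm ▸ hvM (σ i)) hx
  have hx : x - M.starProjection x ∈ Mᗮ := M.sub_starProjection_mem_orthogonal x
  have h1 : (R : H →L[ℂ] H) x =
      (R : H →L[ℂ] H) (M.starProjection x) + (x - M.starProjection x) := by
    rw [← show (R : H →L[ℂ] H) (x - M.starProjection x) = x - M.starProjection x from
      hR (Sum.inr ⟨_, hx⟩), ← map_add, add_sub_cancel]
  change (R : H →L[ℂ] H) (M.starProjection x) = M.starProjection ((R : H →L[ℂ] H) x)
  rw [h1, map_add, Submodule.starProjection_eq_self_iff.2 (hRM _ (M.starProjection_apply_mem x)),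
    (Submodule.starProjection_apply_eq_zero_iff M).2 hx, add_zero]

end Reindex

/-! ### The operators `U` and `T` from an invariant Gram kernel. -/

section BaumslagSolitar

variable {H : Type*} [NormedAddCommGroup H] [InnerProductSpace ℂ H] [CompleteSpace H]

theorem unitary_zpow_apply (V : unitary (H →L[ℂ] H)) (g : ℤ → H)
    (hg : ∀ k, (V : H →L[ℂ] H) (g k) = g (k + 1)) (n k : ℤ) :
    ((V ^ n : unitary (H →L[ℂ] H)) : H →L[ℂ] H) (g k) = g (n + k) := by
  have hinv : ∀ k, ((V⁻¹ : unitary (H →L[ℂ] H)) : H →L[ℂ] H) (g k) = g (k - 1) := fun k => by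
    have h := hg (k - 1)
    rw [sub_add_cancel] at h
    rw [← h]
    exact DFunLike.congr_fun (congrArg Subtype.val (inv_mul_cancel V)) _
  induction n with
  | zero => simp
  | succ n ih =>
    rw [add_comm, zpow_one_add]
    change V.1 ((V ^ (n : ℤ)).1 (g k)) = _
    rw [ih, hg]
    congr 1
    ring
  | pred n ih =>
    rw [sub_eq_neg_add, zpow_add, zpow_neg_one]
    change (V⁻¹).1 ((V ^ (-n : ℤ)).1 (g k)) = _
    rw [ih, hinv]
    congr 1
    ring

theorem exists_unitary_pair_of_invariant_gram (e : ℤ × ℤ → H)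
    (he : (Submodule.span ℂ (Set.range e)).topologicalClosure = ⊤)
    (h₁ : ∀ j j' k k' : ℤ,
      inner ℂ (e (j' + 1, k')) (e (j + 1, k)) = inner ℂ (e (j', k')) (e (j, k)))
    (h₂ : ∀ j j' k k' : ℤ, j ≤ 0 → j' ≤ 0 →
      inner ℂ (e (j', 2 ^ (-j').toNat + k')) (e (j, 2 ^ (-j).toNat + k)) =
        inner ℂ (e (j', k')) (e (j, k))) :
    ∃ U T : unitary (H →L[ℂ] H), U * T * U⁻¹ = T * T ∧
      ∀ j k : ℤ, ((U ^ j * T ^ k : unitary (H →L[ℂ] H)) : H →L[ℂ] H) (e (0, 0)) = e (j, k) := by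
  obtain ⟨U, hU⟩ := exists_unitary_apply_eq_comp e (fun p => (p.1 + 1, p.2))
    (fun p => ⟨(p.1 - 1, p.2), by simp⟩) he (fun p q => h₁ _ _ _ _)
  have hUpow : ∀ n j k : ℤ, ((U ^ n : unitary (H →L[ℂ] H)) : H →L[ℂ] H) (e (j, k)) =
      e (n + j, k) := fun n j k => unitary_zpow_apply U (fun j => e (j, k)) (fun j => hU (j, k)) n j
  have hUinv : ∀ j k : ℤ, ((U⁻¹ : unitary (H →L[ℂ] H)) : H →L[ℂ] H) (e (j, k)) =
      e (j - 1, k) := fun j k => by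
    rw [← zpow_neg_one, hUpow, neg_add_eq_sub]
  let J := {p : ℤ × ℤ // p.1 ≤ 0}
  obtain ⟨X, hX, hXM⟩ := exists_unitary_apply_eq_comp_of_closure_span (fun p : J => e p.1)
    (fun p => ⟨(p.1.1, 2 ^ (-p.1.1).toNat + p.1.2), p.2⟩)
    (fun p => ⟨⟨(p.1.1, p.1.2 - 2 ^ (-p.1.1).toNat), p.2⟩, by ext <;> simp⟩)
    (fun p q => h₂ _ _ _ _ q.2 p.2)
  have hX' : ∀ j k : ℤ, j ≤ 0 → (X : H →L[ℂ] H) (e (j, k)) = e (j, 2 ^ (-j).toNat + k) :=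
    fun j k hj => hX ⟨(j, k), hj⟩
  set M := (Submodule.span ℂ (Set.range fun p : J => e p.1)).topologicalClosure
  have heM : ∀ j k : ℤ, j ≤ 0 → e (j, k) ∈ M := fun j k hj =>
    Submodule.le_topologicalClosure _ (Submodule.subset_span ⟨⟨(j, k), hj⟩, rfl⟩)
  obtain ⟨T, hUT, hT⟩ := exists_unitary_conj_eq_sq U X M
    (fun x hx => ContinuousLinearMap.map_mem_of_mem_closure_span
      (Submodule.isClosed_topologicalClosure _) _ (by
        rintro _ ⟨⟨⟨j, k⟩, hj⟩, rfl⟩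
        change (U⁻¹).1 (e (j, k)) ∈ M
        rw [hUinv]
        exact heM _ _ (by simp only at hj; omega)) hx)
    (by
      refine top_unique (he.symm.le.trans
        (Submodule.topologicalClosure_mono (Submodule.span_mono ?_)))
      rintro _ ⟨⟨j, k⟩, rfl⟩
      -- `j - j.toNat = min j 0`, so a positive `j` is reached from `e (0, k)` by `U ^ j`.
      refine ⟨(j.toNat, ⟨e (j - j.toNat, k), heM _ _ (by omega)⟩), ?_⟩
      have := hUpow j.toNat (j - j.toNat) k
      rwa [add_sub_cancel, zpow_natCast] at this)
    hXM
    (fun x hx => ContinuousLinearMap.eq_of_mem_closure_span (by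
        rintro _ ⟨⟨⟨j, k⟩, hj⟩, rfl⟩
        simp only at hj
        change U.1 (X.1 ((U⁻¹).1 (e (j, k)))) = X.1 (X.1 (e (j, k)))
        rw [hUinv, hX' _ _ (by omega), hX' _ _ hj, hX' _ _ hj, hU]
        -- Lowering `j` by one doubles the translation `2 ^ (-j)`; this is the source of `X²`.
        have h : (-(j - 1)).toNat = (-j).toNat + 1 := by omega
        rw [h, pow_succ]
        ring_nf) hx)
  refine ⟨U, T, hUT, ?_⟩
  have hTe : ∀ k : ℤ, (T : H →L[ℂ] H) (e (0, k)) = e (0, k + 1) := fun k => by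
    rw [hT _ (heM 0 k le_rfl), hX' 0 k le_rfl, add_comm]
    simp
  intro j k
  change (U ^ j).1 ((T ^ k).1 (e (0, 0))) = _
  rw [unitary_zpow_apply T (fun k => e (0, k)) hTe, hUpow, add_zero, add_zero]

end BaumslagSolitar

/-! ### The representation and the extended kernel. -/

theorem mainTheorem2 (K : ℤ × ℤ → ℤ × ℤ → ℂ) (hK : IsPositiveDefiniteKernel K)
    (hinv₁ : ∀ j j' k k' : ℤ, K (j, k) (j', k') = K (j + 1, k) (j' + 1, k'))
    (hinv₂ : ∀ j j' k k' : ℤ, j ≤ 0 → j' ≤ 0 →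
      K (j, k) (j', k') = K (j, 2 ^ (-j).toNat + k) (j', 2 ^ (-j').toNat + k')) :
    ∃ (H : Type) (_ : NormedAddCommGroup H) (_ : InnerProductSpace ℂ H) (_ : CompleteSpace H)
      (ρ : BS12Representation H) (ψ : H),
      (∀ j j' k k' : ℤ,
        inner ℂ (ρ.waveletVec ψ j' k') (ρ.waveletVec ψ j k) = K (j, k) (j', k')) ∧
      (Submodule.span ℂ
        (Set.range fun p : ℤ × ℤ => ρ.waveletVec ψ p.1 p.2)).topologicalClosure = ⊤ ∧
      ∃ L : BS12 → BS12 → ℂ,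
        (∀ x y : BS12, L x y = inner ℂ ((ρ y : H →L[ℂ] H) ψ) ((ρ x : H →L[ℂ] H) ψ)) ∧
        IsPositiveDefiniteKernel L ∧
        (∀ g x y : BS12, L (g * x) (g * y) = L x y) ∧
        ∀ j j' k k' : ℤ,
          L (BS12.u ^ j * BS12.t ^ k) (BS12.u ^ j' * BS12.t ^ k') = K (j, k) (j', k') := by
  obtain ⟨H, _, _, _, e, heK, he⟩ := hK.exists_kolmogorov
  obtain ⟨U, T, hUT, hψ⟩ := exists_unitary_pair_of_invariant_gram e he
    (fun j j' k k' => by rw [heK, heK, ← hinv₁])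
    (fun j j' k k' hj hj' => by rw [heK, heK, ← hinv₂ j j' k k' hj hj'])
  let f : BSGen → unitary (H →L[ℂ] H) := fun g => BSGen.casesOn g U T
  let ρ : BS12Representation H := PresentedGroup.toGroup (f := f) (by
    rintro r rfl
    simp only [map_mul, map_inv, map_pow, FreeGroup.lift_apply_of]
    rw [mul_inv_eq_one, pow_two]
    exact hUT)
  have hρu : ρ BS12.u = U := PresentedGroup.toGroup.of _
  have hρt : ρ BS12.t = T := PresentedGroup.toGroup.of _
  have hρ : ∀ j k : ℤ, ((ρ (BS12.u ^ j * BS12.t ^ k) : unitary (H →L[ℂ] H)) : H →L[ℂ] H)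
      (e (0, 0)) = e (j, k) := fun j k => by
    rw [map_mul, map_zpow, map_zpow, hρu, hρt, hψ]
  have hwave : ∀ j k : ℤ, ρ.waveletVec (e (0, 0)) j k = e (j, k) := fun j k => by
    rw [← hρ j k, map_mul, map_zpow, map_zpow]
    rfl
  refine ⟨H, _, _, _, ρ, e (0, 0), fun j j' k k' => by rw [hwave, hwave, heK], ?_,
    fun x y => inner ℂ ((ρ y : H →L[ℂ] H) (e (0, 0))) ((ρ x : H →L[ℂ] H) (e (0, 0))),
    fun _ _ => rfl, fun n x ξ => ?_, fun g x y => ?_, fun j j' k k' => ?_⟩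
  · simpa only [hwave] using he
  -- The quadratic form of `L` is the squared norm of `∑ i, ξ i • ρ (x i) ψ`, with `ψ = e (0, 0)`.
  · have h : ∑ i, ∑ j, inner ℂ ((ρ (x j) : H →L[ℂ] H) (e (0, 0)))
          ((ρ (x i) : H →L[ℂ] H) (e (0, 0))) * ξ i * star (ξ j) =
        inner ℂ (∑ i, ξ i • (ρ (x i) : H →L[ℂ] H) (e (0, 0)))
          (∑ i, ξ i • (ρ (x i) : H →L[ℂ] H) (e (0, 0))) := by
      simp only [sum_inner, inner_sum, inner_smul_left, inner_smul_right]
      refine Finset.sum_congr rfl fun i _ => ?_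
      rw [Finset.mul_sum]
      refine Finset.sum_congr rfl fun j _ => ?_
      rw [starRingEnd_apply]
      ring
    rw [h]
    generalize ∑ i, ξ i • (ρ (x i) : H →L[ℂ] H) (e (0, 0)) = y
    rw [inner_self_eq_norm_sq_to_K]
    exact pow_nonneg (Complex.zero_le_real.2 (norm_nonneg y)) 2
  · simp only [map_mul]
    exact Unitary.inner_map_map (ρ g) _ _
  · simp only [hρ, heK]
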